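/- Let $$\mathrm v=\left(2x_2-6x_3+\tfrac16(x_2-y_2)x_2\right)\frac{\partial}{\partial x_2}+\left(3x_3-\tfrac13x_2^2+\tfrac14(x_2-y_2)x_3\right)\frac{\partial}{\partial x_3}-\left(2y_2-6y_3+\tfrac16(y_2-x_2)y_2\right)\frac{\partial}{\partial y_2}-\left(3y_3-\tfrac13y_2^2+\tfrac14(y_2-x_2)y_3\right)\frac{\partial}{\partial y_3},$$ regarded as a derivation of $\mathbb Q[x_2,x_3,y_2,y_3]$. Let $d\ge 1$ be an integer, $\psi(d)=d\prod_{p\mid d}(1+\frac1p)$ the Dedekind function, $i\in\{1,2,3\}$, and put $y_1:=1$. Let $\alpha_{i,1},\dots,\alpha_{i,m_{d,i}}$ be the monomials $y_i^{a_1}x_2^{a_2}x_3^{a_3}$, one for each triple of integers $a_1,a_2,a_3\ge 0$ with $i a_1+2a_2+3a_3=i\,\psi(d)$, enumerated in any order. Let $B_{d,i}$ be the $m_{d,i}\times m_{d,i}$ matrix whose $r$-th row, $0\le r\le m_{d,i}-1$, is $(\mathrm v^r(\alpha_{i,1}),\dots,\mathrm v^r(\alpha_{i,m_{d,i}}))$,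 and let $J_{d,i}:=\det B_{d,i}\in\mathbb Q[x_2,x_3,y_2,y_3]$. Let $g_1=\frac{2\pi i}{12}E_2$, $g_2=12\left(\frac{2\pi i}{12}\right)^2E_4$, $g_3=8\left(\frac{2\pi i}{12}\right)^3E_6$ on the upper half plane $\mathbb H$ (here $i=\sqrt{-1}$), where $E_2,E_4,E_6$ are the Eisenstein series of level one with constant term $1$. Let $S_0(d)$ be the algebraic curve in the complex weighted projective space $\mathbb P^{2,3,2,3,1}$ with coordinates $[x_2:x_3:y_2:y_3:y_1]$ which is the Zariski closure of the image of the map $$\mathbb H\to\mathbb P^{2,3,2,3,1},\quad \tau\mapsto\left[g_2(\tau):g_3(\tau):d^2g_2(d\tau):-d^3g_3(d\tau):g_1(\tau)-d\,g_1(d\tau)\right],$$ that is, of the modular curve $X_0(d)$ without its cusps. Then for every $d\ge 1$ and every $i=1,2,3$ the polynomial $J_{d,i}$ vanishes on $S_0(d)$: for every $(x_2,x_3,y_2,y_3)\in\mathbb C^4$ with $[x_2:x_3:y_2:y_3:1]\in S_0(d)$ one has $J_{d,i}(x_2,x_3,y_2,y_3)=0$. -/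

import Mathlib

noncomputable section

namespace ModularFoliation

open MvPolynomial

/-! ### The vector field `v` and the matrices `B_{d,i}` -/

/-- The polynomial ring `ℚ[x₂, x₃, y₂, y₃]`, with the variables in this order. -/
abbrev Poly : Type := MvPolynomial (Fin 4) ℚ

def x₂ : Poly := X 0
def x₃ : Poly := X 1
def y₂ : Poly := X 2
def y₃ : Poly := X 3

/-- The quadratic vector field `v` on `ℂ⁴`, as a derivation of `ℚ[x₂, x₃, y₂, y₃]`. -/
def v : Derivation ℚ Poly Poly :=
  mkDerivation ℚ
    ![2 * x₂ - 6 * x₃ + C (1 / 6) * (x₂ - y₂) * x₂,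
      3 * x₃ - C (1 / 3) * x₂ ^ 2 + C (1 / 4) * (x₂ - y₂) * x₃,
      -(2 * y₂ - 6 * y₃ + C (1 / 6) * (y₂ - x₂) * y₂),
      -(3 * y₃ - C (1 / 3) * y₂ ^ 2 + C (1 / 4) * (y₂ - x₂) * y₃)]

/-- The Dedekind function `ψ(d) = d ∏_{p ∣ d} (1 + 1/p)`; the division below is exact. -/
def psi (d : ℕ) : ℕ :=
  (d / ∏ p ∈ d.primeFactors, p) * ∏ p ∈ d.primeFactors, (p + 1)

theorem psi_cast (d : ℕ) :
    (psi d : ℚ) = d * ∏ p ∈ d.primeFactors, (1 + 1 / (p : ℚ)) := by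
  have hne : (∏ p ∈ d.primeFactors, (p : ℚ)) ≠ 0 :=
    Finset.prod_ne_zero_iff.mpr fun p hp =>
      Nat.cast_ne_zero.mpr (Nat.prime_of_mem_primeFactors hp).ne_zero
  have hprod : (∏ p ∈ d.primeFactors, (1 + 1 / (p : ℚ)))
      = (∏ p ∈ d.primeFactors, ((p : ℚ) + 1)) / ∏ p ∈ d.primeFactors, (p : ℚ) := by
    rw [← Finset.prod_div_distrib]
    refine Finset.prod_congr rfl fun p hp => ?_
    have : (p : ℚ) ≠ 0 := Nat.cast_ne_zero.mpr (Nat.prime_of_mem_primeFactors hp).ne_zero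
    field_simp
  rw [psi, hprod, Nat.cast_mul, Nat.cast_div (Nat.prod_primeFactors_dvd d)
    (by rw [Nat.cast_prod]; exact hne)]
  push_cast
  ring

/-- The triples `(a₁, a₂, a₃)` of natural numbers with `i a₁ + 2 a₂ + 3 a₃ = i ψ(d)`
(see `mem_exponents`; the bounds on the entries are automatic for `i ≥ 1`). -/
def exponents (d i : ℕ) : Finset (ℕ × ℕ × ℕ) :=
  (Finset.range (i * psi d + 1) ×ˢ Finset.range (i * psi d + 1) ×ˢ
    Finset.range (i * psi d + 1)).filter
      fun a => i * a.1 + 2 * a.2.1 + 3 * a.2.2 = i * psi d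

theorem mem_exponents {d i : ℕ} (hi : 1 ≤ i) (a : ℕ × ℕ × ℕ) :
    a ∈ exponents d i ↔ i * a.1 + 2 * a.2.1 + 3 * a.2.2 = i * psi d := by
  simp only [exponents, Finset.mem_filter, Finset.mem_product, Finset.mem_range,
    and_iff_right_iff_imp]
  intro h
  have h1 : a.1 ≤ i * a.1 := Nat.le_mul_of_pos_left _ hi
  omega

/-- The number `m_{d,i}` of monomials. -/
def m (d i : ℕ) : ℕ := (exponents d i).card

/-- The element `y_i` of `ℚ[x₂, x₃, y₂, y₃]` for `i = 1, 2, 3`, where `y₁ = 1`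
(no other index is used). -/
def y : ℕ → Poly
  | 1 => 1
  | 2 => y₂
  | 3 => y₃
  | _ => 0

/-- The monomial `y_i ^ a₁ * x₂ ^ a₂ * x₃ ^ a₃`. -/
def mono (i : ℕ) (a : ℕ × ℕ × ℕ) : Poly := y i ^ a.1 * x₂ ^ a.2.1 * x₃ ^ a.2.2

/-- The matrix `B_{d,i}` attached to an enumeration `α_{i,1}, α_{i,2}, …` of the monomials: the
entry in row `r` and column `j` (both counted from `0`) is `v^r` applied to the `j`-th monomial. -/
def B (d i : ℕ) (e : Fin (m d i) ≃ exponents d i) : Matrix (Fin (m d i)) (Fin (m d i)) Poly :=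
  Matrix.of fun r j => (v^[(r : ℕ)]) (mono i (e j))

/-- The polynomial `J_{d,i} = det B_{d,i}`. -/
def J (d i : ℕ) (e : Fin (m d i) ≃ exponents d i) : Poly := (B d i e).det

/-! ### The weighted projective space of weights `(2, 3, 2, 3, 1)` -/

/-- The weights of the homogeneous coordinates `[x₂ : x₃ : y₂ : y₃ : y₁]`. -/
def wt : Fin 5 → ℕ := ![2, 3, 2, 3, 1]

/-- Two nonzero vectors are equivalent if they lie in one orbit of the weighted action of `ℂˣ`. -/
def orbitSetoid : Setoid {u : Fin 5 → ℂ // u ≠ 0} where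
  r u u' := ∃ c : ℂˣ, ∀ k, u'.1 k = (c : ℂ) ^ wt k * u.1 k
  iseqv :=
    { refl := fun u => ⟨1, fun k => by simp⟩
      symm := by
        rintro u u' ⟨c, h⟩
        refine ⟨c⁻¹, fun k => ?_⟩
        rw [h k, ← mul_assoc, ← mul_pow, Units.inv_mul, one_pow, one_mul]
      trans := by
        rintro u u' u'' ⟨c, h⟩ ⟨c', h'⟩
        refine ⟨c' * c, fun k => ?_⟩
        rw [h' k, h k, Units.val_mul, mul_pow, mul_assoc] }

/-- The weighted projective space `ℙ^{2,3,2,3,1}` over `ℂ` (its set of points). -/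
def WProj : Type := Quotient orbitSetoid

/-- The point with homogeneous coordinates `u`. -/
def WProj.mk (u : Fin 5 → ℂ) (hu : u ≠ 0) : WProj := Quotient.mk orbitSetoid ⟨u, hu⟩

/-- The affine chart `y₁ = 1`: the point `[x₂ : x₃ : y₂ : y₃ : 1]` for
`p = (x₂, x₃, y₂, y₃) ∈ ℂ⁴`. -/
def chart (p : Fin 4 → ℂ) : WProj :=
  WProj.mk ![p 0, p 1, p 2, p 3, 1] fun h => one_ne_zero (congrFun h 4)

/-- The form `F` vanishes at the point `P`. -/
def VanishesAt (F : MvPolynomial (Fin 5) ℂ) (P : WProj) : Prop :=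
  ∀ (u : Fin 5 → ℂ) (hu : u ≠ 0), WProj.mk u hu = P → eval u F = 0

/-- The Zariski closure of a set of points: the common zeros of all weighted homogeneous
polynomials that vanish on the set. -/
def zariskiClosure (S : Set WProj) : Set WProj :=
  {P | ∀ (n : ℕ) (F : MvPolynomial (Fin 5) ℂ), IsWeightedHomogeneous wt F n →
    (∀ Q ∈ S, VanishesAt F Q) → VanishesAt F P}

/-! ### The curve `S₀(d)` -/

open UpperHalfPlane

/-- The constant `2πi / 12`. -/
def κ : ℂ := 2 * Real.pi * Complex.I / 12

/-- `g₁ = (2πi/12) E₂` -/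
def g₁ (τ : ℍ) : ℂ := κ * EisensteinSeries.E2 τ

/-- `g₂ = 12 (2πi/12)² E₄` -/
def g₂ (τ : ℍ) : ℂ := 12 * κ ^ 2 * ModularForm.E (k := 4) (by norm_num) τ

/-- `g₃ = 8 (2πi/12)³ E₆` -/
def g₃ (τ : ℍ) : ℂ := 8 * κ ^ 3 * ModularForm.E (k := 6) (by norm_num) τ

/-- The point `d τ` of the upper half plane. -/
def scale (d : ℕ+) (τ : ℍ) : ℍ :=
  UpperHalfPlane.mk ((d : ℂ) * (τ : ℂ)) (by
    have hd : (0 : ℝ) < (d : ℕ) := Nat.cast_pos.mpr d.pos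
    simpa using mul_pos hd τ.im_pos)

/-- Homogeneous coordinates of the image of `τ` under the modular parametrization
`X₀(d) → ℙ^{2,3,2,3,1}`. -/
def modularVec (d : ℕ+) (τ : ℍ) : Fin 5 → ℂ :=
  ![g₂ τ, g₃ τ, (d : ℂ) ^ 2 * g₂ (scale d τ), -((d : ℂ) ^ 3 * g₃ (scale d τ)),
    g₁ τ - (d : ℂ) * g₁ (scale d τ)]

/-- The set of points `[g₂(τ) : g₃(τ) : d² g₂(dτ) : -d³ g₃(dτ) : g₁(τ) - d g₁(dτ)]`, `τ ∈ ℍ`, the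
image of the modular curve `X₀(d)` without its cusps. -/
def modularImage (d : ℕ+) : Set WProj :=
  {P | ∃ (τ : ℍ) (hu : modularVec d τ ≠ 0), P = WProj.mk (modularVec d τ) hu}

/-- The algebraic curve `S₀(d)` in `ℙ^{2,3,2,3,1}`: the Zariski closure of the image of the
modular curve. -/
def S₀ (d : ℕ+) : Set WProj := zariskiClosure (modularImage d)

end ModularFoliation

end

open UpperHalfPlane hiding I
open ModularForm EisensteinSeries Derivative Filter Complex
open scoped MatrixGroups Manifold Topology ModularForm

noncomputable section
namespace ModularFoliation

open CongruenceSubgroup Matrix.SpecialLinearGroup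

/-! On the modular curve the function `yFun d i` is a modular form of weight `2 * i` for Γ₀(d)
(`exists_modularForm_eq_yFun`), and Γ₀(d) has index at most ψ(d) (`Gamma0_index_le_psi`). Such a
form is a root of the monic polynomial whose roots are its conjugates. The coefficients are level
one forms, hence isobaric polynomials in `g₂` and `g₃` (`levelOne_mem_weightedSpan`). After
multiplication by a power of the form, this is a nontrivial linear relation with constant
coefficients c among the monomials of weight iψ(d) (`exists_yFun_relation`).

Dividing by the power of y₁ of that weight gives the same relation in affine coordinates. By
Ramanujan's identities these coordinates satisfy dx/dτ = y₁ · v(x) (`hasDerivAt_affineCoord`), so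
differentiating the relation r times shows that c also annihilates the row of the v^r(α_j). Thus c
is a nonzero kernel vector of B at every modular point with y₁ ≠ 0, and J vanishes there.

To reach the Zariski closure, J is homogenized in a degree exceeding all its weights. The resulting
form also vanishes on y₁ = 0, hence on the whole modular image, and returns J in the chart y₁ = 1.
-/

/-! ### Limits at i∞ and Ramanujan's identities -/

/-- A power series in `q = exp (2πiτ)` tends to its constant coefficient at `i∞`. -/
theorem tendsto_atImInfty_of_hasSum {f : ℍ → ℂ} {c : ℕ → ℂ}
    (hf : ∀ τ : ℍ, HasSum (fun n ↦ c n • Function.Periodic.qParam 1 τ ^ n) (f τ)) :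
    Tendsto f atImInfty (𝓝 (c 0)) := by
  set q : ℍ → ℂ := fun τ ↦ Function.Periodic.qParam 1 τ with hq
  have hq0 (τ : ℍ) : q τ ≠ 0 := Function.Periodic.qParam_ne_zero _
  -- The quotient is again a power series in q, hence bounded; multiplying back by q → 0 gives the
  -- limit.
  have hg : IsBoundedAtImInfty fun τ ↦ (f τ - c 0) / q τ := by
    refine isBoundedAtImInfty_of_hasSum_qExpansion (c := fun n ↦ c (n + 1)) one_pos fun τ ↦ ?_
    have h := (hasSum_nat_add_iff' 1).mpr (hf τ)
    simp only [Finset.range_one, Finset.sum_singleton, pow_zero, smul_eq_mul, mul_one] at h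
    convert! h.div_const (q τ) using 2 with n
    simp only [smul_eq_mul, hq, pow_succ]
    rw [← mul_assoc, mul_div_cancel_right₀ _ (hq0 τ)]
  have hq' : Tendsto q atImInfty (𝓝 0) := qParam_tendsto_atImInfty one_pos
  have h0 : Tendsto (fun τ ↦ q τ * ((f τ - c 0) / q τ)) atImInfty (𝓝 0) :=
    by
    have := ((Asymptotics.isLittleO_one_iff ℝ).mpr hq').mul_isBigO hg
    exact (Asymptotics.isLittleO_one_iff ℝ).mp (by simpa using this)
  have := h0.add_const (c 0)
  simpa [mul_div_cancel₀ _ (hq0 _)] using this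

theorem tendsto_E2 : Tendsto E2 atImInfty (𝓝 1) := by
  have := tendsto_atImInfty_of_hasSum (f := E2)
    (c := fun m ↦ if m = 0 then 1 else -24 * ArithmeticFunction.sigma 1 m) fun τ ↦ by
    simpa only [Function.Periodic.qParam, ofReal_one, div_one] using hasSum_qExpansion_E2 (z := τ)
  simpa using this

theorem tendsto_E {k : ℕ} (hk : 3 ≤ k) (hk2 : Even k) : Tendsto (E hk) atImInfty (𝓝 1) := by
  have := tendsto_atImInfty_of_hasSum (f := E hk) fun τ ↦
    ModularForm.hasSum_qExpansion (E hk) one_pos one_mem_strictPeriods_SL τ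
  rwa [E_qExpansion_coeff_zero hk hk2] at this

/-- The derivative of a holomorphic function that is bounded at `i∞` tends to zero there. -/
theorem tendsto_normalizedDerivOfComplex {F : ℍ → ℂ} (hF : MDiff F) (hb : IsBoundedAtImInfty F) :
    Tendsto (D F) atImInfty (𝓝 0) := by
  obtain ⟨M, A, hMA⟩ := isBoundedAtImInfty_iff.mp hb
  -- Cauchy's estimate on a disc of half the distance to the line Im = max A 0; the radius grows
  -- with Im τ.
  have hder (τ : ℍ) (hτ : max A 0 + 1 ≤ τ.im) :
      ‖deriv (F ∘ ofComplex) τ‖ ≤ M / (τ.im - max A 0) * 2 := by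
    have hR : 0 < (τ.im - max A 0) / 2 := by linarith
    have him (z : ℂ) (hz : z ∈ Metric.closedBall (τ : ℂ) ((τ.im - max A 0) / 2)) :
        max A 0 < z.im := by
      have h1 : |(z - τ).im| ≤ (τ.im - max A 0) / 2 :=
        (abs_im_le_norm _).trans (by simpa [Complex.dist_eq] using hz)
      have h2 := (abs_le.mp h1).1
      simp only [sub_im, coe_im] at h2
      linarith
    have hd : DiffContOnCl ℂ (F ∘ ofComplex) (Metric.ball (τ : ℂ) ((τ.im - max A 0) / 2)) := by
      refine DifferentiableOn.diffContOnCl fun z hz ↦ ?_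
      rw [closure_ball _ hR.ne'] at hz
      have : 0 < z.im := (le_max_right A 0).trans_lt (him z hz)
      exact (mdifferentiableAt_iff.mp (hF ⟨z, this⟩)).differentiableWithinAt
    have hC (z : ℂ) (hz : z ∈ Metric.sphere (τ : ℂ) ((τ.im - max A 0) / 2)) :
        ‖(F ∘ ofComplex) z‖ ≤ M := by
      have h1 := him z (Metric.sphere_subset_closedBall hz)
      have h0 : 0 < z.im := (le_max_right A 0).trans_lt h1
      rw [Function.comp_apply, ofComplex_apply_of_im_pos h0]
      exact hMA _ ((le_max_left A 0).trans h1.le)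
    calc _ ≤ _ := norm_deriv_le_of_forall_mem_sphere_norm_le hR hd hC
      _ = _ := by rw [div_div_eq_mul_div]; ring
  have hlim : Tendsto (fun τ : ℍ ↦ M / (τ.im - max A 0) * 2) atImInfty (𝓝 0) := by
    have h1 : Tendsto (fun x : ℝ ↦ M / (x - max A 0) * 2) atTop (𝓝 (0 * 2)) :=
      (tendsto_const_nhds.div_atTop (tendsto_atTop_add_const_right _ _ tendsto_id)).mul_const 2
    rw [zero_mul] at h1
    exact h1.comp tendsto_comap
  have hz : Tendsto (fun τ : ℍ ↦ deriv (F ∘ ofComplex) τ) atImInfty (𝓝 0) :=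
    squeeze_zero_norm' ((atImInfty_mem _).mpr ⟨_, hder⟩) hlim
  have := hz.const_mul (2 * Real.pi * I : ℂ)⁻¹
  rwa [mul_zero] at this

/-- A modular form of level one from a holomorphic `SL(2, ℤ)`-invariant function bounded at `i∞`. -/
def levelOneForm {k : ℤ} (f : ℍ → ℂ) (hs : ∀ γ : SL(2, ℤ), f ∣[k] γ = f) (hd : MDiff f)
    (hb : IsBoundedAtImInfty f) : ModularForm 𝒮ℒ k where
  toFun := f
  slash_action_eq' := by
    rintro _ ⟨γ, rfl⟩
    exact hs γ
  holo' := hd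
  bdd_at_cusps' hc := by
    rw [OnePoint.isBoundedAt_iff_forall_SL2Z hc]
    intro γ _
    rwa [hs γ]

theorem E_slash {k : ℕ} (hk : 3 ≤ k) (γ : SL(2, ℤ)) : (E hk : ℍ → ℂ) ∣[(k : ℤ)] γ = E hk :=
  (E hk).slash_action_eq' _ ⟨γ, rfl⟩

/-- In a one-dimensional space the scalar is read off from the limit at i∞, where `E hk` tends to 1.
-/
theorem eq_smul_E {k : ℕ} (hk : 3 ≤ k) (hk2 : Even k) (hr : Module.rank ℂ (ModularForm 𝒮ℒ k) = 1)
    {f : ℍ → ℂ} (hs : ∀ γ : SL(2, ℤ), f ∣[(k : ℤ)] γ = f) (hd : MDiff f) {c : ℂ}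
    (hc : Tendsto f atImInfty (𝓝 c)) (τ : ℍ) : f τ = c * E hk τ := by
  obtain ⟨a, ha⟩ := (finrank_eq_one_iff_of_nonzero' (E hk) (E_ne_zero hk hk2)).mp
    (Module.rank_eq_one_iff_finrank_eq_one.mp hr) (levelOneForm f hs hd (hc.isBigO_one ℝ))
  have hf (τ : ℍ) : a * E hk τ = f τ := DFunLike.congr_fun ha τ
  have h1 : Tendsto f atImInfty (𝓝 (a * 1)) := by
    rw [← funext hf]
    exact (tendsto_E hk hk2).const_mul a
  rw [← hf τ, tendsto_nhds_unique hc h1, mul_one]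

theorem serreDerivative_E_slash {k : ℕ} (hk : 3 ≤ k) (γ : SL(2, ℤ)) :
    serreDerivative k (E hk) ∣[(k + 2 : ℤ)] γ = serreDerivative k (E hk) := by
  simpa using serreDerivative_slash_invariant (k := k) (E hk).holo' (E_slash hk γ)

theorem tendsto_serreDerivative_E {k : ℕ} (hk : 3 ≤ k) (hk2 : Even k) :
    Tendsto (serreDerivative k (E hk)) atImInfty (𝓝 (-(k : ℂ) / 12)) := by
  have := (tendsto_normalizedDerivOfComplex (E hk).holo' ((tendsto_E hk hk2).isBigO_one ℝ)).sub
    ((tendsto_E2.const_mul ((k : ℂ) * 12⁻¹)).mul (tendsto_E hk hk2))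
  rw [serreDerivative_eq]
  convert! this using 2
  ring

theorem D_E₄ (τ : ℍ) : D E₄ τ = (E2 τ * E₄ τ - E₆ τ) / 3 := by
  have := eq_smul_E (k := 6) (by norm_num) ⟨3, rfl⟩ levelOne_weight_six_rank_one
    (fun γ ↦ serreDerivative_E_slash (k := 4) (by norm_num) γ)
    (serreDerivative_mdifferentiable _ (E₄).holo')
    (tendsto_serreDerivative_E (by norm_num) ⟨2, rfl⟩) τ
  rw [serreDerivative_apply] at this
  push_cast at this
  linear_combination this

theorem levelOne_weight_eight_rank_one : Module.rank ℂ (ModularForm 𝒮ℒ (8 : ℕ)) = 1 := by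
  rw [dimension_level_one 8 ⟨4, rfl⟩]
  simp [Nat.ModEq]

/-- The Serre derivative of E₆ and E₄² are both multiples of E₈, with limits -1/2 and 1. -/
theorem D_E₆ (τ : ℍ) : D E₆ τ = (E2 τ * E₆ τ - E₄ τ ^ 2) / 2 := by
  have h1 := eq_smul_E (k := 8) (by norm_num) ⟨4, rfl⟩ levelOne_weight_eight_rank_one
    (fun γ ↦ serreDerivative_E_slash (k := 6) (by norm_num) γ)
    (serreDerivative_mdifferentiable _ (E₆).holo')
    (tendsto_serreDerivative_E (by norm_num) ⟨3, rfl⟩) τ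
  have h2 := eq_smul_E (k := 8) (by norm_num) ⟨4, rfl⟩ levelOne_weight_eight_rank_one
    (f := E₄ * E₄) (fun γ ↦ (mul_slash_SL2 4 4 γ E₄ E₄).trans
      (by rw [show (E₄ : ℍ → ℂ) ∣[(4 : ℤ)] γ = E₄ from E_slash (k := 4) (by norm_num) γ]))
    ((E₄).holo'.mul (E₄).holo')
    ((tendsto_E (k := 4) (by norm_num) ⟨2, rfl⟩).mul (tendsto_E (k := 4) (by norm_num) ⟨2, rfl⟩)) τ
  rw [serreDerivative_apply] at h1
  rw [Pi.mul_apply] at h2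
  push_cast at h1
  linear_combination h1 + h2 / 2

/-- `D E₂ - E₂² / 12` is modular of weight four. -/
theorem serreDerivative_E2_slash (γ : SL(2, ℤ)) :
    (D E2 - (12⁻¹ : ℂ) • (E2 * E2)) ∣[(4 : ℤ)] γ = D E2 - (12⁻¹ : ℂ) • (E2 * E2) := by
  ext z
  have hz : denom γ z ≠ 0 := denom_ne_zero γ z
  have h1 (z : ℂ) : HasDerivAt (fun w : ℂ ↦ denom γ w) (γ 1 0 : ℂ) z := by
    have := ((hasDerivAt_id z).const_mul (γ 1 0 : ℂ)).add_const (γ 1 1 : ℂ)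
    simpa [denom] using this
  have hD2 : D (D2 γ) z = -((γ 1 0 : ℂ) / denom γ z) ^ 2 := by
    have h2 : HasDerivAt (D2 γ ∘ ofComplex)
        ((0 * denom γ z - 2 * Real.pi * I * γ 1 0 * γ 1 0) / denom γ z ^ 2) (z : ℂ) := by
      refine ((hasDerivAt_const (z : ℂ) (2 * Real.pi * I * γ 1 0 : ℂ)).fun_div (h1 z) hz).congr_of_eventuallyEq ?_
      filter_upwards [isOpen_upperHalfPlaneSet.mem_nhds z.im_pos] with w hw
      simp [D2, ofComplex_apply_of_im_pos hw]
    rw [normalizedDerivOfComplex, h2.deriv]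
    have : (2 * Real.pi * I : ℂ) ≠ 0 := two_pi_I_ne_zero
    field_simp
    ring
  have hD2d : MDiff (D2 γ) := by
    rw [UpperHalfPlane.mdifferentiable_iff]
    have : DifferentiableOn ℂ (fun w : ℂ ↦ 2 * Real.pi * I * γ 1 0 / denom γ w) {z | 0 < z.im} := by
      intro w hw
      refine DifferentiableAt.differentiableWithinAt ?_
      refine (differentiableAt_const _).fun_div (h1 w).differentiableAt
        (denom_ne_zero γ ⟨w, hw⟩)
    refine this.congr fun w hw ↦ ?_
    simp [D2, ofComplex_apply_of_im_pos hw]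
  -- E₂ ∣ γ differs from E₂ by a constant multiple of `D2 γ`; the resulting defects of D E₂ and of
  -- E₂² / 12 cancel.
  have hE2 := E2_slash_action γ
  have hd := congrFun (normalizedDerivOfComplex_SL_slash (k := 2) E2_mdifferentiable (γ := γ)) z
  have hm : (((E2 * E2 : ℍ → ℂ)) ∣[(4 : ℤ)] γ) z = (E2 ∣[(2 : ℤ)] γ) z * (E2 ∣[(2 : ℤ)] γ) z :=
    congrFun (mul_slash_SL2 2 2 γ E2 E2) z
  rw [sub_eq_add_neg, SlashAction.add_slash, SlashAction.neg_slash, SL_smul_slash]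
  simp only [Pi.add_apply, Pi.neg_apply, Pi.smul_apply, smul_eq_mul, hm]
  rw [hE2, normalizedDerivOfComplex_sub _ _ E2_mdifferentiable (hD2d.const_smul _),
    normalizedDerivOfComplex_smul _ _ hD2d] at hd
  simp only [Pi.sub_apply, Pi.smul_apply, smul_eq_mul, hD2, Int.reduceAdd] at hd
  rw [hE2]
  simp only [Pi.sub_apply, Pi.smul_apply, smul_eq_mul, Pi.mul_apply]
  have hζ : (riemannZeta 2 : ℂ) = Real.pi ^ 2 / 6 := riemannZeta_two
  have hπ : (Real.pi : ℂ) ≠ 0 := ofReal_ne_zero.mpr Real.pi_ne_zero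
  simp only [D2, hζ] at hd ⊢
  have hI : I ^ 2 = -1 := I_sq
  have hA : 1 / (2 * ((Real.pi : ℂ) ^ 2 / 6)) * (2 * Real.pi * I * γ 1 0 / denom γ z)
      = 6 * I * ((γ 1 0 : ℂ) / denom γ z) / Real.pi := by
    field_simp
  have hB : ((2 : ℤ) : ℂ) * (2 * Real.pi * I)⁻¹ = -I / Real.pi := by
    have hI0 : I ≠ 0 := I_ne_zero
    push_cast
    field_simp
    linear_combination hI
  have hC : 1 / (2 * ((Real.pi : ℂ) ^ 2 / 6)) = 3 / Real.pi ^ 2 := by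
    field_simp
    norm_num
  rw [hA, hB, hC] at hd
  rw [hA]
  generalize (γ 1 0 : ℂ) / denom γ z = s at *
  generalize (Real.pi : ℂ) = p at *
  field_simp at hd ⊢
  linear_combination -12 * hd + 36 * s ^ 2 * hI

theorem D_E2 (τ : ℍ) : D E2 τ = (E2 τ ^ 2 - E₄ τ) / 12 := by
  have hlim : Tendsto (D E2 - (12⁻¹ : ℂ) • (E2 * E2)) atImInfty (𝓝 (-1 / 12)) := by
    have := (tendsto_normalizedDerivOfComplex E2_mdifferentiable isBoundedAtImInfty_E2).sub
      ((tendsto_E2.mul tendsto_E2).const_smul (12⁻¹ : ℂ))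
    convert! this using 2
    simp only [smul_eq_mul]
    ring
  have := eq_smul_E (k := 4) (by norm_num) ⟨2, rfl⟩ levelOne_weight_four_rank_one
    serreDerivative_E2_slash
    ((normalizedDerivOfComplex_mdifferentiable E2_mdifferentiable).sub
      ((E2_mdifferentiable.mul E2_mdifferentiable).const_smul _)) hlim τ
  simp only [Pi.sub_apply, Pi.smul_apply, Pi.mul_apply, smul_eq_mul] at this
  linear_combination this

/-! ### The index of Γ₀(d) -/

/-- Evaluating φ on chosen representatives injects the cosets into T, so φ need not be constant on
cosets. -/
theorem relIndex_le_of_separating {G T : Type*} [Group G] [Finite T] (H K : Subgroup G) (φ : K → T)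
    (hφ : ∀ a b : K, φ a = φ b → (a : G)⁻¹ * b ∈ H) : H.relIndex K ≤ Nat.card T := by
  refine Nat.card_le_card_of_injective (fun q : K ⧸ H.subgroupOf K ↦ φ q.out) fun q q' h ↦ ?_
  have := hφ _ _ h
  rw [← q.out_eq', ← q'.out_eq']
  exact QuotientGroup.eq.mpr (Subgroup.mem_subgroupOf.mpr (by simpa using this))

theorem mem_Gamma0_iff_dvd {N : ℕ} {γ : SL(2, ℤ)} : γ ∈ Gamma0 N ↔ (N : ℤ) ∣ γ 1 0 := by
  rw [Gamma0_mem, ZMod.intCast_zmod_eq_zero_iff_dvd]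

theorem inv_mul_lower_left (γ γ' : SL(2, ℤ)) :
    (γ⁻¹ * γ') 1 0 = γ 0 0 * γ' 1 0 - γ 1 0 * γ' 0 0 := by
  rw [Matrix.SpecialLinearGroup.coe_mul, Matrix.SpecialLinearGroup.coe_inv,
    Matrix.adjugate_fin_two, Matrix.mul_apply, Fin.sum_univ_two]
  simp
  ring

theorem inv_mul_mem_Gamma0 {d p : ℕ} {γ γ' : SL(2, ℤ)} (h : γ ∈ Gamma0 d) (h' : γ' ∈ Gamma0 d)
    (hp : (γ 0 0 * (γ' 1 0 / d : ℤ) - (γ 1 0 / d : ℤ) * γ' 0 0 : ZMod p) = 0) :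
    γ⁻¹ * γ' ∈ Gamma0 (p * d) := by
  rw [mem_Gamma0_iff_dvd] at h h' ⊢
  rw [inv_mul_lower_left]
  have h1 : (p : ℤ) ∣ γ 0 0 * (γ' 1 0 / d) - (γ 1 0 / d) * γ' 0 0 := by
    rw [← ZMod.intCast_zmod_eq_zero_iff_dvd]
    push_cast
    exact hp
  have := mul_dvd_mul_right h1 (d : ℤ)
  rw [sub_mul, mul_assoc, Int.ediv_mul_cancel h', mul_right_comm, Int.ediv_mul_cancel h] at this
  exact_mod_cast this

/-- A coset is separated by the point (a : c/d) of the projective line over 𝔽_p, where (a, c) is the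
first column; `none` is the point with a = 0. -/
theorem Gamma0_relIndex_le (d p : ℕ) [Fact p.Prime] :
    (Gamma0 (p * d)).relIndex (Gamma0 d) ≤ p + 1 := by
  have := relIndex_le_of_separating (Gamma0 (p * d)) (Gamma0 d) (T := Option (ZMod p))
    (fun γ ↦ if (γ.1 0 0 : ZMod p) = 0 then none else some ((γ.1 1 0 / d : ℤ) / (γ.1 0 0 : ZMod p)))
    fun γ γ' h ↦ by
      refine inv_mul_mem_Gamma0 γ.2 γ'.2 ?_
      split_ifs at h with h1 h2 h2
      · simp [h1, h2]
      · rw [Option.some_inj, div_eq_div_iff h1 h2] at h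
        linear_combination -h
  simpa [Nat.card_eq_fintype_card, ZMod.card] using this

/-- Here p divides c, so the determinant forces a ≠ 0 mod p and the point at infinity does not
occur. -/
theorem Gamma0_relIndex_le_of_dvd {d p : ℕ} [Fact p.Prime] (hpd : p ∣ d) :
    (Gamma0 (p * d)).relIndex (Gamma0 d) ≤ p := by
  have hne (γ : Gamma0 d) : (γ.1 0 0 : ZMod p) ≠ 0 := fun h0 ↦ by
    have hc : (γ.1 1 0 : ZMod p) = 0 := by
      rw [ZMod.intCast_zmod_eq_zero_iff_dvd]
      exact (Int.natCast_dvd_natCast.mpr hpd).trans (mem_Gamma0_iff_dvd.mp γ.2)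
    have hdet := congrArg (Int.cast : ℤ → ZMod p) γ.1.det_coe
    rw [Matrix.det_fin_two] at hdet
    push_cast at hdet
    rw [h0, hc] at hdet
    simp at hdet
  have := relIndex_le_of_separating (Gamma0 (p * d)) (Gamma0 d) (T := ZMod p)
    (fun γ ↦ ((γ.1 1 0 / d : ℤ) / (γ.1 0 0 : ZMod p))) fun γ γ' h ↦ by
      refine inv_mul_mem_Gamma0 γ.2 γ'.2 ?_
      rw [div_eq_div_iff (hne γ) (hne γ')] at h
      linear_combination -h
  simpa [Nat.card_eq_fintype_card, ZMod.card] using this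

theorem psi_prime_mul {p d : ℕ} (hp : p.Prime) (hd : d ≠ 0) :
    psi (p * d) = (if p ∣ d then p else p + 1) * psi d := by
  have hp0 : (p : ℚ) ≠ 0 := Nat.cast_ne_zero.mpr hp.ne_zero
  suffices (psi (p * d) : ℚ) = (if p ∣ d then p else p + 1) * psi d by
    split_ifs at this ⊢ <;> exact_mod_cast this
  rw [psi_cast, psi_cast, Nat.primeFactors_mul hp.ne_zero hd, hp.primeFactors]
  split_ifs with h
  · rw [Finset.union_eq_right.mpr (by simpa using ⟨hp, h, hd⟩)]
    push_cast
    ring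
  · rw [Finset.prod_union (by simpa using fun _ h' ↦ (h h').elim), Finset.prod_singleton]
    push_cast
    field_simp

theorem Gamma0_index_le_psi {d : ℕ} (hd : d ≠ 0) : (Gamma0 d).index ≤ psi d := by
  induction d using induction_on_primes with
  | zero => exact (hd rfl).elim
  | one =>
    have : Gamma0 1 = ⊤ := by
      ext γ
      simpa using Subsingleton.elim (α := ZMod 1) _ _
    simp [this, psi]
  | prime_mul p d hp ih =>
    have := Fact.mk hp
    have hd' : d ≠ 0 := right_ne_zero_of_mul hd
    have hle : Gamma0 (p * d) ≤ Gamma0 d := fun γ h ↦ by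
      rw [mem_Gamma0_iff_dvd] at h ⊢
      exact (Int.natCast_dvd_natCast.mpr (Dvd.intro_left p rfl)).trans h
    rw [← Subgroup.relIndex_mul_index hle, psi_prime_mul hp hd']
    refine Nat.mul_le_mul ?_ (ih hd')
    split_ifs with h
    · exact Gamma0_relIndex_le_of_dvd h
    · exact Gamma0_relIndex_le d p

/-! ### Level one forms as polynomials in g₂ and g₃ -/

/-- The space of functions on `ℍ` spanned by the monomials `g₂ ^ a * g₃ ^ b` with
`2 * a + 3 * b = n`. -/
def weightedSpan (n : ℕ) : Submodule ℂ (ℍ → ℂ) :=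
  Submodule.span ℂ {F | ∃ a b : ℕ, 2 * a + 3 * b = n ∧ F = g₂ ^ a * g₃ ^ b}

theorem mul_mem_weightedSpan {m n : ℕ} {F G : ℍ → ℂ} (hF : F ∈ weightedSpan m)
    (hG : G ∈ weightedSpan n) : F * G ∈ weightedSpan (m + n) := by
  have := Submodule.mul_mem_mul hF hG
  rw [weightedSpan, weightedSpan, Submodule.span_mul_span] at this
  refine Submodule.span_mono ?_ this
  rintro _ ⟨_, ⟨a, b, h, rfl⟩, _, ⟨a', b', h', rfl⟩, rfl⟩
  exact ⟨a + a', b + b', by omega, by simp only [pow_add]; ring⟩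

theorem one_mem_weightedSpan : (1 : ℍ → ℂ) ∈ weightedSpan 0 :=
  Submodule.subset_span ⟨0, 0, rfl, by simp⟩

theorem pow_mem_weightedSpan {n : ℕ} {F : ℍ → ℂ} (hF : F ∈ weightedSpan n) (k : ℕ) :
    F ^ k ∈ weightedSpan (k * n) := by
  induction k with
  | zero => simpa using one_mem_weightedSpan
  | succ k ih =>
    rw [pow_succ, Nat.succ_mul]
    exact mul_mem_weightedSpan ih hF

theorem κ_ne_zero : κ ≠ 0 := by
  simp [κ, Real.pi_ne_zero]

theorem E₄_mem_weightedSpan : (E₄ : ℍ → ℂ) ∈ weightedSpan 2 := by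
  have : (E₄ : ℍ → ℂ) = (12 * κ ^ 2)⁻¹ • g₂ := by
    ext τ
    have := κ_ne_zero
    simp only [g₂, Pi.smul_apply, smul_eq_mul]
    field_simp
  rw [this]
  exact Submodule.smul_mem _ _ (Submodule.subset_span ⟨1, 0, rfl, by simp⟩)

theorem E₆_mem_weightedSpan : (E₆ : ℍ → ℂ) ∈ weightedSpan 3 := by
  have : (E₆ : ℍ → ℂ) = (8 * κ ^ 3)⁻¹ • g₃ := by
    ext τ
    have := κ_ne_zero
    simp only [g₃, Pi.smul_apply, smul_eq_mul]
    field_simp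
  rw [this]
  exact Submodule.smul_mem _ _ (Submodule.subset_span ⟨0, 1, rfl, by simp⟩)

theorem discriminant_mem_weightedSpan : (discriminant : ℍ → ℂ) ∈ weightedSpan 6 := by
  have : (discriminant : ℍ → ℂ) = (1728 : ℂ)⁻¹ • ((E₄ : ℍ → ℂ) ^ 3 - (E₆ : ℍ → ℂ) ^ 2) := by
    ext τ
    simp [discriminant_eq_E₄_cube_sub_E₆_sq, div_eq_inv_mul]
  rw [this]
  exact Submodule.smul_mem _ _ (Submodule.sub_mem _ (pow_mem_weightedSpan E₄_mem_weightedSpan 3)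
    (pow_mem_weightedSpan E₆_mem_weightedSpan 2))

theorem tendsto_levelOne {k : ℤ} (f : ModularForm 𝒮ℒ k) :
    Tendsto f atImInfty (𝓝 ((qExpansion 1 f).coeff 0)) :=
  tendsto_atImInfty_of_hasSum fun τ ↦
    ModularForm.hasSum_qExpansion f one_pos one_mem_strictPeriods_SL τ

/-- Level one modular forms are isobaric polynomials in `g₂` and `g₃`. -/
theorem levelOne_mem_weightedSpan (n : ℕ) (f : ModularForm 𝒮ℒ (2 * n : ℤ)) :
    (f : ℍ → ℂ) ∈ weightedSpan n := by
  induction n using Nat.strong_induction_on with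
  | _ n ih =>
  obtain rfl | rfl | hn : n = 0 ∨ n = 1 ∨ 2 ≤ n := by omega
  · obtain ⟨c, hc⟩ := ModularFormClass.levelOne_weight_zero_const (mcast (b := 0) (by simp) f)
    have : (f : ℍ → ℂ) = c • 1 := by
      ext τ
      simpa using congrFun hc τ
    rw [this]
    exact Submodule.smul_mem _ _ one_mem_weightedSpan
  · have : f = 0 := rank_zero_iff_forall_zero.mp levelOne_weight_two_rank_zero f
    rw [this, FunLike.coe_zero]
    exact Submodule.zero_mem _
  obtain ⟨a, b, hab⟩ : ∃ a b : ℕ, 2 * a + 3 * b = n :=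
    ⟨(n - 3 * (n % 2)) / 2, n % 2, by omega⟩
  let h : ModularForm 𝒮ℒ (2 * n : ℤ) := mcast (by push_cast [← hab]; ring) ((E₄.pow a).mul (E₆.pow b))
  have hh : (h : ℍ → ℂ) = (E₄ : ℍ → ℂ) ^ a * (E₆ : ℍ → ℂ) ^ b := by
    rw [← ModularForm.coe_pow, ← ModularForm.coe_pow, ← ModularForm.coe_mul]
    rfl
  have hmem : (h : ℍ → ℂ) ∈ weightedSpan n := by
    rw [hh, ← hab, mul_comm 2, mul_comm 3]
    exact mul_mem_weightedSpan (pow_mem_weightedSpan E₄_mem_weightedSpan a)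
      (pow_mem_weightedSpan E₆_mem_weightedSpan b)
  have hlim : Tendsto h atImInfty (𝓝 1) := by
    rw [hh]
    have := ((tendsto_E (k := 4) (by norm_num) ⟨2, rfl⟩).pow a).mul
      ((tendsto_E (k := 6) (by norm_num) ⟨3, rfl⟩).pow b)
    rwa [one_pow, one_pow, one_mul] at this
  set c := (qExpansion 1 f).coeff 0
  have h0 : (qExpansion 1 (f - c • h)).coeff 0 = 0 := by
    refine tendsto_nhds_unique (tendsto_levelOne (f - c • h)) ?_
    have := (tendsto_levelOne f).sub (hlim.const_mul c)
    rwa [mul_one, sub_self] at this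
  -- Subtracting a multiple of a monomial with limit 1 leaves a cusp form. It is divisible by the
  -- discriminant, and the quotient has weight 2n - 12, to which induction applies.
  have hdec : (f : ℍ → ℂ) = c • (h : ℍ → ℂ) +
      discriminant * (CuspForm.discriminantEquiv (toCuspForm (f - c • h) h0) : ℍ → ℂ) := by
    rw [discriminant_mul_discriminantEquiv]
    ext τ
    simp
  rw [hdec]
  refine Submodule.add_mem _ (Submodule.smul_mem _ _ hmem) ?_
  rcases lt_or_ge n 6 with hn6 | hn6
  · rw [ModularFormClass.levelOne_neg_weight_eq_zero (by omega), mul_zero]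
    exact Submodule.zero_mem _
  · have := ih (n - 6) (by omega) (mcast (by omega)
      (CuspForm.discriminantEquiv (toCuspForm (f - c • h) h0)))
    have h2 := mul_mem_weightedSpan discriminant_mem_weightedSpan this
    rwa [show 6 + (n - 6) = n by omega] at h2

/-! ### The algebraic equation of a modular form over level one -/

section Relation

variable {Γ : Subgroup (GL (Fin 2) ℝ)}

/-- This makes the trace of f^j the j-th power sum of the conjugates of f. -/
theorem quotientFunc_pow [Γ.HasDetPlusMinusOne] {k : ℤ} (f : ModularForm Γ k) (j : ℕ) (q : 𝒮ℒ ⧸ Γ.subgroupOf 𝒮ℒ) :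
    SlashInvariantForm.quotientFunc (f.pow j) q = SlashInvariantForm.quotientFunc f q ^ j := by
  induction q using Quotient.inductionOn with
  | h r =>
    obtain ⟨γ, hγ⟩ := inv_mem r.2
    simp only [SlashInvariantForm.quotientFunc_mk, ModularForm.coe_pow, ← hγ]
    ext τ
    change (((f : ℍ → ℂ) ^ j : ℍ → ℂ) ∣[(j * k : ℤ)] γ) τ = ((f : ℍ → ℂ) ∣[k] γ) τ ^ j
    rw [SL_slash_apply, SL_slash_apply, Pi.pow_apply, mul_pow, ← zpow_natCast (denom _ _ ^ _) j,
      ← zpow_mul, neg_mul, mul_comm k]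

variable [Fintype (𝒮ℒ ⧸ Γ.subgroupOf 𝒮ℒ)]

/-- The elementary symmetric functions of the conjugates of a modular form. -/
def conjEsymm {k : ℤ} (f : ModularForm Γ k) (n : ℕ) : ℍ → ℂ :=
  (Finset.univ.val.map (SlashInvariantForm.quotientFunc (ℋ := 𝒮ℒ) f)).esymm n

/-- Newton's identities express n times the n-th elementary symmetric function through lower ones
and power sums; the power sums are traces, hence of level one. -/
theorem conjEsymm_mem_weightedSpan [Γ.IsFiniteRelIndex 𝒮ℒ] [Γ.HasDetPlusMinusOne] {i : ℕ}
    (f : ModularForm Γ (2 * i : ℤ)) (n : ℕ) :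
    conjEsymm f n ∈ weightedSpan (n * i) := by
  induction n using Nat.strong_induction_on with
  | _ n ih =>
  rcases Nat.eq_zero_or_pos n with rfl | hn
  · simpa [conjEsymm, Multiset.esymm] using one_mem_weightedSpan
  have hpsum (j : ℕ) : ∑ q, (SlashInvariantForm.quotientFunc (ℋ := 𝒮ℒ) f q) ^ j ∈
      weightedSpan (j * i) := by
    have := levelOne_mem_weightedSpan (j * i)
      (mcast (by push_cast; ring) (ModularForm.trace 𝒮ℒ (f.pow j)))
    convert! this using 1
    simp only [coe_mcast, ModularForm.coe_trace, quotientFunc_pow]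
    congr!
  have hN := congrArg (MvPolynomial.aeval (SlashInvariantForm.quotientFunc (ℋ := 𝒮ℒ) f))
    (MvPolynomial.mul_esymm_eq_sum (𝒮ℒ ⧸ Γ.subgroupOf 𝒮ℒ) ℂ n)
  simp only [map_mul, map_natCast, map_pow, map_neg, map_one, map_sum, MvPolynomial.psum,
    MvPolynomial.aeval_X, MvPolynomial.aeval_esymm_eq_multiset_esymm] at hN
  have hn0 : (n : ℂ) ≠ 0 := Nat.cast_ne_zero.mpr hn.ne'
  have hsmul : (n : ℂ) • conjEsymm f n ∈ weightedSpan (n * i) := by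
    have : (n : ℂ) • conjEsymm f n = (n : ℍ → ℂ) * conjEsymm f n := by
      ext τ
      simp
    rw [this, conjEsymm, hN]
    have hneg (j : ℕ) (F : ℍ → ℂ) (hF : F ∈ weightedSpan (n * i)) :
        (-1) ^ j * F ∈ weightedSpan (n * i) := by
      rcases neg_one_pow_eq_or (ℍ → ℂ) j with h | h <;> rw [h]
      · simpa using hF
      · simpa using hF
    refine hneg _ _ (Submodule.sum_mem _ fun a ha ↦ ?_)
    rw [Finset.mem_filter, Finset.HasAntidiagonal.mem_antidiagonal] at ha
    rw [mul_assoc]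
    refine hneg _ _ ?_
    have := mul_mem_weightedSpan (ih _ ha.2) (hpsum a.2)
    rwa [← add_mul, ha.1] at this
  simpa [smul_smul, hn0] using Submodule.smul_mem _ (n : ℂ)⁻¹ hsmul

/-- The trivial coset makes f one of its own conjugates, hence a root of the polynomial with these
roots. -/
theorem sum_conjEsymm_mul_pow {k : ℤ} (f : ModularForm Γ k) :
    ∑ j ∈ Finset.range (Fintype.card (𝒮ℒ ⧸ Γ.subgroupOf 𝒮ℒ) + 1),
      (-1) ^ j * (conjEsymm f j * (f : ℍ → ℂ) ^ (Fintype.card (𝒮ℒ ⧸ Γ.subgroupOf 𝒮ℒ) - j)) = 0 := by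
  have h := congrArg (Polynomial.eval (f : ℍ → ℂ)) (Multiset.prod_X_sub_X_eq_sum_esymm
    (Finset.univ.val.map (SlashInvariantForm.quotientFunc (ℋ := 𝒮ℒ) f)))
  rw [Polynomial.eval_finsetSum] at h
  simp only [Polynomial.eval_mul, Polynomial.eval_pow, Polynomial.eval_neg, Polynomial.eval_one,
    Polynomial.eval_C, Polynomial.eval_X, Multiset.card_map, Finset.card_val, Finset.card_univ] at h
  refine h.symm.trans ?_
  rw [Polynomial.eval_multiset_prod]
  refine Multiset.prod_eq_zero (Multiset.mem_map.mpr ⟨_, Multiset.mem_map.mpr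
    ⟨_, Multiset.mem_map.mpr ⟨⟦1⟧, Finset.mem_univ_val _, rfl⟩, rfl⟩, ?_⟩)
  simp

/-- A modular form whose number of conjugates is at most `N` satisfies an isobaric equation of
degree `N` over the ring of level one modular forms. -/
theorem pow_mem_span [Γ.IsFiniteRelIndex 𝒮ℒ] [Γ.HasDetPlusMinusOne] {i N : ℕ}
    (f : ModularForm Γ (2 * i : ℤ)) (hN : Fintype.card (𝒮ℒ ⧸ Γ.subgroupOf 𝒮ℒ) ≤ N) :
    (f : ℍ → ℂ) ^ N ∈ Submodule.span ℂ ((fun a : ℕ × ℕ × ℕ ↦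
      (f : ℍ → ℂ) ^ a.1 * g₂ ^ a.2.1 * g₃ ^ a.2.2) ''
        {a | i * a.1 + 2 * a.2.1 + 3 * a.2.2 = i * N ∧ a ≠ (N, 0, 0)}) := by
  set n := Fintype.card (𝒮ℒ ⧸ Γ.subgroupOf 𝒮ℒ)
  -- The factor f^(N - n) raises the degree to exactly N, which is why an upper bound for the index
  -- suffices.
  have h := congrArg ((f : ℍ → ℂ) ^ (N - n) * ·) (sum_conjEsymm_mul_pow f)
  simp only [Finset.sum_range_succ', mul_zero] at h
  have h0 : conjEsymm f 0 = 1 := by simp [conjEsymm, Multiset.esymm]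
  rw [h0, pow_zero, one_mul, one_mul, Nat.sub_zero, mul_add, ← pow_add, Nat.sub_add_cancel hN,
    Finset.mul_sum] at h
  rw [← neg_eq_of_add_eq_zero_right h]
  refine Submodule.neg_mem _ (Submodule.sum_mem _ fun j hj ↦ ?_)
  have hj' : j + 1 ≤ n := Finset.mem_range.mp hj
  have hlin : (f : ℍ → ℂ) ^ (N - n) * ((-1) ^ (j + 1) *
      (conjEsymm f (j + 1) * (f : ℍ → ℂ) ^ (n - (j + 1)))) =
      (-1 : ℂ) ^ (j + 1) • LinearMap.mulLeft ℂ ((f : ℍ → ℂ) ^ (N - (j + 1)))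
        (conjEsymm f (j + 1)) := by
    rw [show N - (j + 1) = (N - n) + (n - (j + 1)) by omega]
    ext τ
    simp
    ring
  rw [hlin]
  refine Submodule.smul_mem _ _ ?_
  have hmem := Submodule.mem_map_of_mem (f := LinearMap.mulLeft ℂ ((f : ℍ → ℂ) ^ (N - (j + 1))))
    (conjEsymm_mem_weightedSpan f (j + 1))
  rw [weightedSpan, Submodule.map_span] at hmem
  refine Submodule.span_mono ?_ hmem
  rintro _ ⟨_, ⟨a, b, hab, rfl⟩, rfl⟩
  refine ⟨(N - (j + 1), a, b), ⟨?_, ?_⟩, mul_assoc _ _ _⟩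
  · obtain ⟨M, rfl⟩ : ∃ M, N = M + (j + 1) := ⟨N - (j + 1), by omega⟩
    simp only [Nat.add_sub_cancel]
    rw [add_assoc, hab]
    ring
  · intro h
    simp only [Prod.mk.injEq] at h
    omega

theorem exists_relation [Γ.IsFiniteRelIndex 𝒮ℒ] [Γ.HasDetPlusMinusOne] {d i : ℕ} (hi : 1 ≤ i)
    (f : ModularForm Γ (2 * i : ℤ)) (hN : Fintype.card (𝒮ℒ ⧸ Γ.subgroupOf 𝒮ℒ) ≤ psi d) :
    ∃ c : exponents d i → ℂ, c ≠ 0 ∧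
      ∀ τ, ∑ a, c a * (f τ ^ a.1.1 * g₂ τ ^ a.1.2.1 * g₃ τ ^ a.1.2.2) = 0 := by
  set F : ℕ × ℕ × ℕ → ℍ → ℂ := fun a ↦ (f : ℍ → ℂ) ^ a.1 * g₂ ^ a.2.1 * g₃ ^ a.2.2 with hF
  have hdep : ¬ LinearIndependent ℂ (fun a : exponents d i ↦ F a) := by
    intro hli
    have hmem : (psi d, 0, 0) ∈ exponents d i := (mem_exponents hi _).mpr (by simp)
    refine hli.notMem_span_image (s := {⟨_, hmem⟩}ᶜ) (x := ⟨_, hmem⟩) (by simp) ?_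
    have := pow_mem_span f hN
    simp only [hF, pow_zero, mul_one]
    refine Submodule.span_mono ?_ this
    rintro _ ⟨a, ⟨ha, hne⟩, rfl⟩
    exact ⟨⟨a, (mem_exponents hi _).mpr ha⟩, by simpa [Subtype.ext_iff] using hne, rfl⟩
  obtain ⟨c, hc, a, ha⟩ := Fintype.not_linearIndependent_iff.mp hdep
  refine ⟨c, fun h ↦ ha (congrFun h a), fun τ ↦ ?_⟩
  have := congrFun hc τ
  simpa [hF] using this

end Relation

/-! ### The functions y_i as modular forms for Γ₀(d) -/

/-- The matrix `diag(d, 1)`. -/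
def diagGL (d : ℕ+) : GL (Fin 2) ℝ :=
  Matrix.GeneralLinearGroup.mkOfDetNeZero !![(d : ℝ), 0; 0, 1] (by simp [Matrix.det_fin_two])

theorem diagGL_smul (d : ℕ+) (τ : ℍ) : diagGL d • τ = scale d τ := by
  have hdet : 0 < (diagGL d).det.val := by
    simp [diagGL, Matrix.GeneralLinearGroup.mkOfDetNeZero]
  ext
  rw [coe_smul_of_det_pos hdet]
  simp [diagGL, Matrix.GeneralLinearGroup.mkOfDetNeZero, num, denom, scale]

theorem slash_diagGL (d : ℕ+) (k : ℕ) (f : ℍ → ℂ) (τ : ℍ) :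
    (f ∣[(k + 1 : ℤ)] diagGL d) τ = (d : ℂ) ^ k * f (scale d τ) := by
  have hdet : 0 < (diagGL d).det.val := by
    simp [diagGL, Matrix.GeneralLinearGroup.mkOfDetNeZero]
  rw [slash_apply, diagGL_smul, σ, if_pos hdet]
  simp [diagGL, Matrix.GeneralLinearGroup.mkOfDetNeZero, denom]
  ring

theorem slash_diagGL_slash_of_mem {d : ℕ+} {k : ℤ} {f : ℍ → ℂ}
    (hf : ∀ γ : SL(2, ℤ), f ∣[k] γ = f) {γ : SL(2, ℤ)} (hγ : γ ∈ Gamma0 d) :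
    (f ∣[k] diagGL d) ∣[k] γ = f ∣[k] diagGL d := by
  obtain ⟨c, hc⟩ := mem_Gamma0_iff_dvd.mp hγ
  have hdet := γ.det_coe
  rw [Matrix.det_fin_two, hc] at hdet
  -- γ' is the conjugate of γ by diag(d, 1), integral because d divides the lower left entry of γ.
  obtain ⟨γ', h00, h01, h10, h11⟩ : ∃ γ' : SL(2, ℤ),
      γ' 0 0 = γ 0 0 ∧ γ' 0 1 = d * γ 0 1 ∧ γ' 1 0 = c ∧ γ' 1 1 = γ 1 1 :=
    ⟨⟨!![γ 0 0, d * γ 0 1; c, γ 1 1], by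
      rw [Matrix.det_fin_two_of]; linear_combination hdet⟩, rfl, rfl, rfl, rfl⟩
  have hmul : diagGL d * mapGL ℝ γ = mapGL ℝ γ' * diagGL d := by
    ext i j
    fin_cases i <;> fin_cases j <;>
      simp [diagGL, Matrix.GeneralLinearGroup.mkOfDetNeZero, Matrix.mul_apply, h00, h01, h10, h11,
        hc, mul_comm]
  change (f ∣[k] diagGL d) ∣[k] mapGL ℝ γ = f ∣[k] diagGL d
  rw [← SlashAction.slash_mul, hmul, SlashAction.slash_mul]
  exact congrArg (· ∣[k] diagGL d) (hf γ')

/-- Factor diag(d, 1) γ = γ' A with γ' in SL(2, ℤ) and A upper triangular: f absorbs γ', and A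
preserves boundedness at i∞. The first column of γ' is that of diag(d, 1) γ divided by its gcd. -/
theorem isBoundedAtImInfty_slash_diagGL_slash {d : ℕ+} {k : ℤ} {f : ℍ → ℂ}
    (hf : ∀ γ : SL(2, ℤ), f ∣[k] γ = f) (hb : IsBoundedAtImInfty f) (γ : SL(2, ℤ)) :
    IsBoundedAtImInfty ((f ∣[k] diagGL d) ∣[k] γ) := by
  have hne : Int.gcd (d * γ 0 0) (γ 1 0) ≠ 0 := by
    intro h
    rw [Int.gcd_eq_zero_iff] at h
    have hdet := γ.det_coe
    have h0 : γ 0 0 = 0 := by simpa using h.1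
    rw [Matrix.det_fin_two, h.2, h0] at hdet
    simp at hdet
  obtain ⟨γ', h0, h1⟩ := IsCoprime.exists_SL2_col
    (Int.isCoprime_iff_gcd_eq_one.mpr (Int.gcd_ediv_gcd_ediv_gcd (Nat.pos_of_ne_zero hne))) 0
  set A := (mapGL ℝ γ')⁻¹ * (diagGL d * mapGL ℝ γ) with hA
  have hmul : diagGL d * mapGL ℝ γ = mapGL ℝ γ' * A := by rw [hA, mul_inv_cancel_left]
  have hA0 : A 1 0 = 0 := by
    have e0 := congrArg (fun M : GL (Fin 2) ℝ ↦ M 0 0) hmul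
    have e1 := congrArg (fun M : GL (Fin 2) ℝ ↦ M 1 0) hmul
    simp [diagGL, Matrix.GeneralLinearGroup.mkOfDetNeZero, Matrix.mul_apply] at e0 e1
    have hdet := congrArg (Int.cast : ℤ → ℝ) γ'.det_coe
    rw [Matrix.det_fin_two] at hdet
    push_cast at hdet
    have hz : γ' 0 0 * γ 1 0 = γ' 1 0 * (d * γ 0 0) := by
      rw [h0, h1]
      obtain ⟨x, hx⟩ := Int.gcd_dvd_left (a := d * γ 0 0) (b := γ 1 0)
      obtain ⟨y, hy⟩ := Int.gcd_dvd_right (a := d * γ 0 0) (b := γ 1 0)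
      have hne' : (Int.gcd (d * γ 0 0) (γ 1 0) : ℤ) ≠ 0 := Int.natCast_ne_zero.mpr hne
      generalize (Int.gcd (d * γ 0 0) (γ 1 0) : ℤ) = e at *
      rw [hx, hy, Int.mul_ediv_cancel_left _ hne', Int.mul_ediv_cancel_left _ hne']
      ring
    have hz' := congrArg (Int.cast : ℤ → ℝ) hz
    push_cast at hz'
    linear_combination (-A 1 0) * hdet + γ' 1 0 * e0 - γ' 0 0 * e1 + hz'
  change IsBoundedAtImInfty ((f ∣[k] diagGL d) ∣[k] mapGL ℝ γ)
  rw [← SlashAction.slash_mul, hmul, SlashAction.slash_mul]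
  exact IsBoundedAtImInfty.slash k hA0 (by rwa [show f ∣[k] mapGL ℝ γ' = f from hf γ'])

/-- A modular form for `Γ₀(d)` from a holomorphic function all of whose translates are bounded. -/
def gamma0Form (d : ℕ+) {k : ℤ} (f : ℍ → ℂ) (hs : ∀ γ ∈ Gamma0 d, f ∣[k] γ = f) (hd : MDiff f)
    (hb : ∀ γ : SL(2, ℤ), IsBoundedAtImInfty (f ∣[k] γ)) :
    ModularForm ((Gamma0 d).map (mapGL ℝ)) k where
  toFun := f
  slash_action_eq' := by
    rintro _ ⟨γ, hγ, rfl⟩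
    exact hs γ hγ
  holo' := hd
  bdd_at_cusps' hc := by
    rw [Subgroup.IsArithmetic.isCusp_iff_isCusp_SL2Z] at hc
    rw [OnePoint.isBoundedAt_iff_forall_SL2Z hc]
    exact fun γ _ ↦ hb γ

/-- The completed Eisenstein series `E₂ - 3 / (π Im τ)`. -/
def E2Star (τ : ℍ) : ℂ := E2 τ - 3 / (Real.pi * τ.im)

theorem E2Star_slash (γ : SL(2, ℤ)) : E2Star ∣[(2 : ℤ)] γ = E2Star := by
  ext τ
  have hE := congrFun (E2_slash_action γ) τ
  have hz : denom γ τ ≠ 0 := denom_ne_zero γ τ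
  have hconj : (starRingEnd ℂ) (denom γ τ) = denom γ τ - 2 * I * (γ 1 0) * τ.im := by
    have : (starRingEnd ℂ) (τ : ℂ) = τ - 2 * I * τ.im := by
      apply Complex.ext <;> simp
      ring
    rw [ModularGroup.denom_apply]
    simp [this]
    ring
  have him : (3 / (Real.pi * (γ • τ).im) : ℂ) * denom γ τ ^ (-2 : ℤ)
      = 3 / (Real.pi * τ.im) - 6 * I * γ 1 0 / (Real.pi * denom γ τ) := by
    have hc0 : (starRingEnd ℂ) (denom γ τ) ≠ 0 := (map_ne_zero _).mpr hz
    have hπ : (Real.pi : ℂ) ≠ 0 := ofReal_ne_zero.mpr Real.pi_ne_zero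
    have hτ : (τ.im : ℂ) ≠ 0 := ofReal_ne_zero.mpr τ.im_ne_zero
    rw [ModularGroup.im_smul_eq_div_normSq]
    push_cast
    rw [← mul_conj, zpow_neg, zpow_ofNat]
    field_simp
    rw [hconj]
    ring
  rw [SL_slash_apply] at hE ⊢
  simp only [E2Star, sub_mul]
  rw [hE, him]
  simp only [Pi.sub_apply, Pi.smul_apply, smul_eq_mul, D2, riemannZeta_two]
  have := Real.pi_ne_zero
  field_simp
  ring

theorem isBoundedAtImInfty_E2Star : IsBoundedAtImInfty E2Star := by
  refine isBoundedAtImInfty_E2.sub ?_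
  have : Tendsto (fun τ : ℍ ↦ (3 / (Real.pi * τ.im) : ℂ)) atImInfty (𝓝 0) := by
    have h1 : Tendsto (fun x : ℝ ↦ 3 / (Real.pi * x)) atTop (𝓝 0) :=
      tendsto_const_nhds.div_atTop (tendsto_id.const_mul_atTop Real.pi_pos)
    have h2 := (continuous_ofReal.tendsto 0).comp (h1.comp (tendsto_comap (f := UpperHalfPlane.im)))
    simpa [Function.comp_def, atImInfty] using h2
  exact this.isBigO_one ℝ

theorem isBoundedAtImInfty_E {k : ℕ} (hk : 3 ≤ k) (hk2 : Even k) : IsBoundedAtImInfty (E hk) :=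
  (tendsto_E hk hk2).isBigO_one ℝ

/-- The holomorphic functions on `ℍ` that give the coordinates `y₁`, `y₂`, `y₃`. -/
def yFun (d : ℕ+) (i : ℕ) (τ : ℍ) : ℂ :=
  match i with
  | 1 => g₁ τ - d * g₁ (scale d τ)
  | 2 => (d : ℂ) ^ 2 * g₂ (scale d τ)
  | _ => -((d : ℂ) ^ 3 * g₃ (scale d τ))

theorem exists_modularForm_eq_smul_E_slash (d : ℕ+) {k : ℕ} (hk : 3 ≤ k) (hk2 : Even k) (c : ℂ) :
    ∃ f : ModularForm ((Gamma0 d).map (mapGL ℝ)) k,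
      (f : ℍ → ℂ) = c • ((E hk : ℍ → ℂ) ∣[(k : ℤ)] diagGL d) :=
  ⟨c • gamma0Form d _ (fun _ h ↦ slash_diagGL_slash_of_mem (E_slash hk) h)
    ((E hk).holo'.slash k _)
    (fun γ ↦ isBoundedAtImInfty_slash_diagGL_slash (E_slash hk) (isBoundedAtImInfty_E hk hk2) γ), rfl⟩

theorem exists_modularForm_eq_yFun (d : ℕ+) {i : ℕ} (hi : i ∈ Finset.Icc 1 3) :
    ∃ f : ModularForm ((Gamma0 d).map (mapGL ℝ)) (2 * i : ℤ), (f : ℍ → ℂ) = yFun d i := by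
  have hd : (d : ℂ) ≠ 0 := Nat.cast_ne_zero.mpr d.ne_zero
  obtain rfl | rfl | rfl : i = 1 ∨ i = 2 ∨ i = 3 := by
    rw [Finset.mem_Icc] at hi
    omega
  -- The non-holomorphic terms of `E2Star` cancel in the difference. This form yields invariance and
  -- boundedness; `heq'` below, with E₂ itself, yields holomorphy.
  · have heq : yFun d 1 = κ • (E2Star - E2Star ∣[(2 : ℤ)] diagGL d) := by
      ext τ
      have := slash_diagGL d 1 E2Star τ
      simp only [Nat.cast_one, Int.reduceAdd, pow_one] at this
      simp only [yFun, g₁, Pi.smul_apply, Pi.sub_apply, smul_eq_mul, this, E2Star]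
      have him : (scale d τ).im = d * τ.im := by
        rw [← coe_im]
        simp [scale]
      rw [him]
      push_cast
      have := Real.pi_ne_zero
      have := τ.im_ne_zero
      field_simp
      ring
    have heq' : yFun d 1 = κ • (E2 - E2 ∣[(2 : ℤ)] diagGL d) := by
      ext τ
      have := slash_diagGL d 1 E2 τ
      simp only [Nat.cast_one, Int.reduceAdd, pow_one] at this
      simp only [yFun, g₁, Pi.smul_apply, Pi.sub_apply, smul_eq_mul, this]
      ring
    refine ⟨gamma0Form d (yFun d 1) (fun γ hγ ↦ ?_) ?_ fun γ ↦ ?_, rfl⟩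
    · rw [heq, SL_smul_slash, sub_eq_add_neg, SlashAction.add_slash, SlashAction.neg_slash]
      erw [E2Star_slash, slash_diagGL_slash_of_mem E2Star_slash hγ]
    · rw [heq']
      exact (E2_mdifferentiable.sub (E2_mdifferentiable.slash 2 _)).const_smul _
    · rw [heq, SL_smul_slash, sub_eq_add_neg, SlashAction.add_slash, SlashAction.neg_slash]
      refine Asymptotics.IsBigO.const_smul_left (.add ?_ (.neg_left ?_)) _
      · erw [E2Star_slash]
        exact isBoundedAtImInfty_E2Star
      · exact isBoundedAtImInfty_slash_diagGL_slash E2Star_slash isBoundedAtImInfty_E2Star γ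
  -- The slash by diag(d, 1) in weight k produces d^(k-1); the powers of d⁻¹ here and for weight 6
  -- correct it to d² and d³.
  · obtain ⟨f, hf⟩ := exists_modularForm_eq_smul_E_slash d (k := 4) (by norm_num) ⟨2, rfl⟩
      (12 * κ ^ 2 * (d : ℂ)⁻¹)
    refine ⟨f, hf.trans ?_⟩
    ext τ
    have := slash_diagGL d 3 (E₄) τ
    simp only [Pi.smul_apply, smul_eq_mul, yFun, g₂]
    erw [this]
    field_simp
  · obtain ⟨f, hf⟩ := exists_modularForm_eq_smul_E_slash d (k := 6) (by norm_num) ⟨3, rfl⟩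
      (-(8 * κ ^ 3 * (d : ℂ)⁻¹ ^ 2))
    refine ⟨f, hf.trans ?_⟩
    ext τ
    have := slash_diagGL d 5 (E₆) τ
    simp only [Pi.smul_apply, smul_eq_mul, yFun, g₃]
    erw [this]
    field_simp

/-- The monomials `y_i ^ a₁ * g₂ ^ a₂ * g₃ ^ a₃` on the modular curve are linearly dependent. -/
theorem exists_yFun_relation (d : ℕ+) {i : ℕ} (hi : i ∈ Finset.Icc 1 3) :
    ∃ c : exponents d i → ℂ, c ≠ 0 ∧
      ∀ τ, ∑ a, c a * (yFun d i τ ^ a.1.1 * g₂ τ ^ a.1.2.1 * g₃ τ ^ a.1.2.2) = 0 := by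
  obtain ⟨f, hf⟩ := exists_modularForm_eq_yFun d hi
  let := Fintype.ofFinite (𝒮ℒ ⧸ ((Gamma0 d).map (mapGL ℝ)).subgroupOf 𝒮ℒ)
  rw [← hf]
  refine exists_relation (Finset.mem_Icc.mp hi).1 f ?_
  rw [← Nat.card_eq_fintype_card]
  change ((Gamma0 d).map (mapGL ℝ)).relIndex 𝒮ℒ ≤ _
  rw [MonoidHom.range_eq_map, ← Subgroup.relIndex_comap,
    Subgroup.comap_map_eq_self_of_injective mapGL_injective, Subgroup.relIndex_top_right]
  exact Gamma0_index_le_psi d.ne_zero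

/-! ### Tangency of the modular curve to v -/

theorem hasDerivAt_comp_ofComplex {F : ℍ → ℂ} (hF : MDiff F) (τ : ℍ) :
    HasDerivAt (F ∘ ofComplex) (12 * κ * D F τ) τ := by
  have h := (mdifferentiableAt_iff.mp (hF τ)).hasDerivAt
  convert! h using 1
  rw [normalizedDerivOfComplex, κ]
  have := two_pi_I_ne_zero
  field_simp

theorem hasDerivAt_g₁ (τ : ℍ) : HasDerivAt (g₁ ∘ ofComplex) (g₁ τ ^ 2 - g₂ τ / 12) τ := by
  convert! (hasDerivAt_comp_ofComplex E2_mdifferentiable τ).const_mul κ using 1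
  rw [D_E2, g₁, g₂]
  ring

theorem hasDerivAt_g₂ (τ : ℍ) :
    HasDerivAt (g₂ ∘ ofComplex) (4 * g₁ τ * g₂ τ - 6 * g₃ τ) τ := by
  convert! (hasDerivAt_comp_ofComplex (E₄).holo' τ).const_mul (12 * κ ^ 2) using 1
  erw [D_E₄]
  rw [g₁, g₂, g₃]
  ring

theorem hasDerivAt_g₃ (τ : ℍ) :
    HasDerivAt (g₃ ∘ ofComplex) (6 * g₁ τ * g₃ τ - g₂ τ ^ 2 / 3) τ := by
  convert! (hasDerivAt_comp_ofComplex (E₆).holo' τ).const_mul (8 * κ ^ 3) using 1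
  erw [D_E₆]
  rw [g₁, g₂, g₃]
  ring

theorem hasDerivAt_comp_scale (d : ℕ+) {F : ℍ → ℂ} {F' : ℂ} {τ : ℍ}
    (hF : HasDerivAt (F ∘ ofComplex) F' (scale d τ : ℍ)) :
    HasDerivAt (fun z : ℂ ↦ F (scale d (ofComplex z))) (d * F') τ := by
  have h1 : HasDerivAt (fun z : ℂ ↦ (d : ℂ) * z) (d : ℂ) τ := by
    simpa using (hasDerivAt_id (τ : ℂ)).const_mul (d : ℂ)
  have h2 := HasDerivAt.comp (τ : ℂ) (show HasDerivAt (F ∘ ofComplex) F' ((d : ℂ) * τ) from hF) h1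
  rw [mul_comm]
  refine h2.congr_of_eventuallyEq ?_
  filter_upwards [isOpen_upperHalfPlaneSet.mem_nhds τ.im_pos] with z hz
  have hz' : 0 < ((d : ℂ) * z).im := by
    have hd : (0 : ℝ) < (d : ℕ) := Nat.cast_pos.mpr d.pos
    simpa using mul_pos hd hz
  rw [Function.comp_apply, Function.comp_apply, ofComplex_apply_of_im_pos hz,
    ofComplex_apply_of_im_pos hz']
  rfl

/-- The affine coordinates `(x₂, x₃, y₂, y₃)` of the point of the modular curve given by `τ`. -/
def affineCoord (d : ℕ+) (τ : ℍ) : Fin 4 → ℂ :=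
  ![g₂ τ / yFun d 1 τ ^ 2, g₃ τ / yFun d 1 τ ^ 3, yFun d 2 τ / yFun d 1 τ ^ 2,
    yFun d 3 τ / yFun d 1 τ ^ 3]

theorem hasDerivAt_yFun_one (d : ℕ+) (τ : ℍ) :
    HasDerivAt (yFun d 1 ∘ ofComplex)
      (yFun d 1 τ * (g₁ τ + d * g₁ (scale d τ)) - (g₂ τ - yFun d 2 τ) / 12) τ := by
  convert! (hasDerivAt_g₁ τ).sub
    ((hasDerivAt_comp_scale d (hasDerivAt_g₁ _)).const_mul (d : ℂ)) using 1
  simp only [yFun]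
  ring

theorem hasDerivAt_yFun_two (d : ℕ+) (τ : ℍ) :
    HasDerivAt (yFun d 2 ∘ ofComplex)
      (4 * (d * g₁ (scale d τ)) * yFun d 2 τ + 6 * yFun d 3 τ) τ := by
  convert! (hasDerivAt_comp_scale d (hasDerivAt_g₂ _)).const_mul ((d : ℂ) ^ 2) using 1
  simp only [yFun]
  ring

theorem hasDerivAt_yFun_three (d : ℕ+) (τ : ℍ) :
    HasDerivAt (yFun d 3 ∘ ofComplex)
      (6 * (d * g₁ (scale d τ)) * yFun d 3 τ + yFun d 2 τ ^ 2 / 3) τ := by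
  convert! ((hasDerivAt_comp_scale d (hasDerivAt_g₃ _)).const_mul ((d : ℂ) ^ 3)).neg using 1
  simp only [yFun]
  ring

theorem hasDerivAt_div_pow {f g : ℂ → ℂ} {f' g' z : ℂ} (hf : HasDerivAt f f' z)
    (hg : HasDerivAt g g' z) (hz : g z ≠ 0) (n : ℕ) :
    HasDerivAt (fun w ↦ f w / g w ^ n) ((f' - n * f z * g' / g z) / g z ^ n) z := by
  convert! hf.fun_div (hg.fun_pow n) (pow_ne_zero n hz) using 1
  rcases n with _ | n
  · simp
  · simp only [Nat.add_sub_cancel]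
    field_simp
    ring

/-- The modular curve is tangent to `v`. -/
theorem hasDerivAt_affineCoord (d : ℕ+) {τ : ℍ} (hτ : yFun d 1 τ ≠ 0) (k : Fin 4) :
    HasDerivAt (fun z : ℂ ↦ affineCoord d (ofComplex z) k)
      (yFun d 1 τ * MvPolynomial.aeval (affineCoord d τ) (v (MvPolynomial.X k))) τ := by
  have hτ' : (yFun d 1 ∘ ofComplex) τ ≠ 0 := by simpa using hτ
  -- After this substitution the remaining g₁ cancels, since each coordinate is a quotient of forms
  -- of equal weight.
  have h1 : (d : ℂ) * g₁ (scale d τ) = g₁ τ - yFun d 1 τ := by simp [yFun]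
  fin_cases k
  · convert! hasDerivAt_div_pow (hasDerivAt_g₂ τ) (hasDerivAt_yFun_one d τ) hτ' 2 using 1
    simp [v, affineCoord, x₂, x₃, y₂, y₃, h1]
    field_simp
    ring
  · convert! hasDerivAt_div_pow (hasDerivAt_g₃ τ) (hasDerivAt_yFun_one d τ) hτ' 3 using 1
    simp [v, affineCoord, x₂, x₃, y₂, y₃, h1]
    field_simp
    ring
  · convert! hasDerivAt_div_pow (hasDerivAt_yFun_two d τ) (hasDerivAt_yFun_one d τ) hτ' 2 using 1
    simp [v, affineCoord, x₂, x₃, y₂, y₃, h1]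
    field_simp
    ring
  · convert! hasDerivAt_div_pow (hasDerivAt_yFun_three d τ) (hasDerivAt_yFun_one d τ) hτ' 3 using 1
    simp [v, affineCoord, x₂, x₃, y₂, y₃, h1]
    field_simp
    ring

/-- The chain rule along an integral curve of w · δ: both sides obey the Leibniz rule, so the
generators suffice. -/
theorem hasDerivAt_aeval {σ : Type*} (δ : Derivation ℚ (MvPolynomial σ ℚ) (MvPolynomial σ ℚ))
    {x : ℂ → σ → ℂ} {z w : ℂ}
    (hx : ∀ k, HasDerivAt (fun z ↦ x z k) (w * MvPolynomial.aeval (x z) (δ (MvPolynomial.X k))) z)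
    (P : MvPolynomial σ ℚ) :
    HasDerivAt (fun z ↦ MvPolynomial.aeval (x z) P) (w * MvPolynomial.aeval (x z) (δ P)) z := by
  induction P using MvPolynomial.induction_on with
  | C a =>
    simpa [← MvPolynomial.algebraMap_eq] using hasDerivAt_const z (algebraMap ℚ ℂ a)
  | add P Q hP hQ =>
    simp only [map_add, mul_add]
    exact hP.add hQ
  | mul_X P k hP =>
    simp only [Derivation.leibniz, map_add, map_mul, smul_eq_mul, MvPolynomial.aeval_X]
    convert! hP.fun_mul (hx k) using 1
    ring

/-- A linear relation that holds along the modular curve can be differentiated along `v`. -/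
theorem sum_aeval_iterate_eq_zero (d : ℕ+) {ι : Type*} [Fintype ι] {c : ι → ℂ} {P : ι → Poly}
    (h : ∀ τ, yFun d 1 τ ≠ 0 → ∑ j, c j * MvPolynomial.aeval (affineCoord d τ) (P j) = 0)
    (r : ℕ) {τ : ℍ} (hτ : yFun d 1 τ ≠ 0) :
    ∑ j, c j * MvPolynomial.aeval (affineCoord d τ) (v^[r] (P j)) = 0 := by
  induction r generalizing τ with
  | zero => exact h τ hτ
  | succ r ih =>
    have hder : HasDerivAt
        (fun z : ℂ ↦ ∑ j, c j * MvPolynomial.aeval (affineCoord d (ofComplex z)) (v^[r] (P j)))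
        (∑ j, c j * (yFun d 1 τ * MvPolynomial.aeval (affineCoord d τ) (v (v^[r] (P j))))) τ := by
      refine HasDerivAt.fun_sum fun j _ ↦ HasDerivAt.const_mul _ ?_
      have := hasDerivAt_aeval v (x := fun z ↦ affineCoord d (ofComplex z)) (z := τ)
        (w := yFun d 1 τ) (by simpa using hasDerivAt_affineCoord d hτ) (v^[r] (P j))
      simpa using this
    have hzero : (fun z : ℂ ↦ ∑ j, c j *
        MvPolynomial.aeval (affineCoord d (ofComplex z)) (v^[r] (P j))) =ᶠ[𝓝 (τ : ℂ)] fun _ ↦ 0 := by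
      -- The condition y₁ ≠ 0 is open, so the inductive relation holds near τ and may be
      -- differentiated.
      filter_upwards [(hasDerivAt_yFun_one d τ).continuousAt.eventually_ne (by simpa using hτ)]
        with z hz using ih hz
    have := hder.unique ((hasDerivAt_const (τ : ℂ) (0 : ℂ)).congr_of_eventuallyEq hzero)
    simp only [Function.iterate_succ_apply']
    refine (mul_eq_zero.mp ?_).resolve_left hτ
    rw [← this, Finset.mul_sum]
    exact Finset.sum_congr rfl fun j _ ↦ by ring

/-! ### Vanishing of J at modular points with y₁ ≠ 0 -/

theorem aeval_y_affineCoord (d : ℕ+) {i : ℕ} (hi : i ∈ Finset.Icc 1 3) {τ : ℍ}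
    (hτ : yFun d 1 τ ≠ 0) :
    MvPolynomial.aeval (affineCoord d τ) (y i) = yFun d i τ * (yFun d 1 τ)⁻¹ ^ i := by
  obtain rfl | rfl | rfl : i = 1 ∨ i = 2 ∨ i = 3 := by
    rw [Finset.mem_Icc] at hi
    omega
  · simp [y, hτ]
  · simp [y, y₂, affineCoord, div_eq_mul_inv]
  · simp [y, y₃, affineCoord, div_eq_mul_inv]

theorem aeval_mono_affineCoord (d : ℕ+) {i : ℕ} (hi : i ∈ Finset.Icc 1 3) {τ : ℍ}
    (hτ : yFun d 1 τ ≠ 0) (a : ℕ × ℕ × ℕ) :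
    MvPolynomial.aeval (affineCoord d τ) (mono i a) =
      (yFun d 1 τ)⁻¹ ^ (i * a.1 + 2 * a.2.1 + 3 * a.2.2) *
        (yFun d i τ ^ a.1 * g₂ τ ^ a.2.1 * g₃ τ ^ a.2.2) := by
  rw [mono, map_mul, map_mul, map_pow, map_pow, map_pow, aeval_y_affineCoord d hi hτ]
  simp only [x₂, x₃, MvPolynomial.aeval_X, affineCoord, Matrix.cons_val_zero, Matrix.cons_val_one,
    div_eq_mul_inv, mul_pow, pow_add, pow_mul, inv_pow]
  ring

theorem aeval_J_affineCoord (d : ℕ+) {i : ℕ} (hi : i ∈ Finset.Icc 1 3)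
    (e : Fin (m d i) ≃ exponents d i) {τ : ℍ} (hτ : yFun d 1 τ ≠ 0) :
    MvPolynomial.aeval (affineCoord d τ) (J d i e) = 0 := by
  obtain ⟨c, hc0, hc⟩ := exists_yFun_relation d hi
  have hrel (τ : ℍ) (hτ : yFun d 1 τ ≠ 0) :
      ∑ j, c (e j) * MvPolynomial.aeval (affineCoord d τ) (mono i (e j)) = 0 := by
    -- All monomials have weight iψ(d), so one common power of y₁⁻¹ passes to affine coordinates.
    have h := congrArg ((yFun d 1 τ)⁻¹ ^ (i * psi d) * ·) (hc τ)
    rw [mul_zero, Finset.mul_sum] at h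
    rw [← h, ← e.sum_comp]
    refine Finset.sum_congr rfl fun j _ ↦ ?_
    rw [aeval_mono_affineCoord d hi hτ,
      (mem_exponents (Finset.mem_Icc.mp hi).1 _).mp (e j).2]
    ring
  rw [J, AlgHom.map_det]
  refine Matrix.exists_mulVec_eq_zero_iff.mp ⟨c ∘ e, fun h ↦ hc0 ?_, ?_⟩
  · ext a
    simpa using congrFun h (e.symm a)
  · ext r
    rw [Pi.zero_apply, ← sum_aeval_iterate_eq_zero d hrel r hτ]
    simp only [Matrix.mulVec, dotProduct, B, AlgHom.mapMatrix_apply, Matrix.map_apply,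
      Matrix.of_apply, Function.comp_apply]
    exact Finset.sum_congr rfl fun j _ ↦ mul_comm _ _

/-! ### Weighted homogenization -/

/-- The exponent in degree `N` homogenizing the monomial with exponent `s`. -/
def homogExponent (N : ℕ) (s : Fin 4 →₀ ℕ) : Fin 5 →₀ ℕ :=
  Finsupp.equivFunOnFinite.symm
    ![s 0, s 1, s 2, s 3, N - (2 * s 0 + 3 * s 1 + 2 * s 2 + 3 * s 3)]

/-- The weighted homogenization of degree `N` of a polynomial in the affine coordinates. -/
def homogenization (N : ℕ) (P : Poly) : MvPolynomial (Fin 5) ℂ :=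
  ∑ s ∈ P.support, MvPolynomial.monomial (homogExponent N s) (algebraMap ℚ ℂ (P.coeff s))

theorem isWeightedHomogeneous_homogenization {N : ℕ} {P : Poly}
    (hN : ∀ s ∈ P.support, 2 * s 0 + 3 * s 1 + 2 * s 2 + 3 * s 3 ≤ N) :
    MvPolynomial.IsWeightedHomogeneous wt (homogenization N P) N := by
  refine MvPolynomial.IsWeightedHomogeneous.sum _ _ N fun s hs ↦
    MvPolynomial.isWeightedHomogeneous_monomial _ _ _ ?_
  have := hN s hs
  rw [Finsupp.weight_apply, Finsupp.sum_fintype _ _ (by simp)]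
  simp [Fin.sum_univ_five, homogExponent, wt]
  omega

theorem eval_homogenization (N : ℕ) (P : Poly) (u : Fin 5 → ℂ) :
    MvPolynomial.eval u (homogenization N P) = ∑ s ∈ P.support, algebraMap ℚ ℂ (P.coeff s) *
      (u 0 ^ s 0 * u 1 ^ s 1 * u 2 ^ s 2 * u 3 ^ s 3 *
        u 4 ^ (N - (2 * s 0 + 3 * s 1 + 2 * s 2 + 3 * s 3))) := by
  rw [homogenization, map_sum]
  refine Finset.sum_congr rfl fun s _ ↦ ?_
  rw [MvPolynomial.eval_monomial, Finsupp.prod_fintype _ _ (by simp)]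
  simp [Fin.prod_univ_five, homogExponent]

theorem eval_homogenization_eq_aeval {N : ℕ} {P : Poly}
    (hN : ∀ s ∈ P.support, 2 * s 0 + 3 * s 1 + 2 * s 2 + 3 * s 3 ≤ N) {u : Fin 5 → ℂ}
    {x : Fin 4 → ℂ} (h0 : u 0 = u 4 ^ 2 * x 0) (h1 : u 1 = u 4 ^ 3 * x 1)
    (h2 : u 2 = u 4 ^ 2 * x 2) (h3 : u 3 = u 4 ^ 3 * x 3) :
    MvPolynomial.eval u (homogenization N P) = u 4 ^ N * MvPolynomial.aeval x P := by
  rw [eval_homogenization, MvPolynomial.aeval_def, MvPolynomial.eval₂_eq', Finset.mul_sum]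
  refine Finset.sum_congr rfl fun s hs ↦ ?_
  obtain ⟨M, hM⟩ := Nat.exists_eq_add_of_le (hN s hs)
  rw [h0, h1, h2, h3, hM, Nat.add_sub_cancel_left, Fin.prod_univ_four]
  simp only [mul_pow, pow_add, pow_mul]
  ring

/-- The strict bound leaves a positive power of y₁ in every term. -/
theorem eval_homogenization_eq_zero {N : ℕ} {P : Poly}
    (hN : ∀ s ∈ P.support, 2 * s 0 + 3 * s 1 + 2 * s 2 + 3 * s 3 < N) {u : Fin 5 → ℂ}
    (hu : u 4 = 0) : MvPolynomial.eval u (homogenization N P) = 0 := by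
  rw [eval_homogenization]
  refine Finset.sum_eq_zero fun s hs ↦ ?_
  rw [hu, zero_pow (Nat.sub_ne_zero_of_lt (hN s hs)), mul_zero, mul_zero]

end ModularFoliation

end

/-- For every `d ≥ 1`, every `i = 1, 2, 3` and every enumeration `e` of the monomials
`y_i ^ a₁ * x₂ ^ a₂ * x₃ ^ a₃` of weighted degree `i ψ(d)`, the polynomial `J_{d,i} = det B_{d,i}`
vanishes at every point `p` of the affine chart `ℂ⁴` of `ℙ^{2,3,2,3,1}` that lies on `S₀(d)`. -/
theorem theorem2 (d : ℕ+) (i : ℕ) (hi : i ∈ Finset.Icc 1 3)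
    (e : Fin (ModularFoliation.m d i) ≃ ModularFoliation.exponents d i)
    (p : Fin 4 → ℂ) (hp : ModularFoliation.chart p ∈ ModularFoliation.S₀ d) :
    MvPolynomial.aeval p (ModularFoliation.J d i e) = 0 := by
  open ModularFoliation in
  set P := J d i e with hP
  -- A crude bound for the weights; the +1 makes the form vanish on y₁ = 0, which contains the whole
  -- modular image when d = 1.
  set N := ∑ s ∈ P.support, (2 * s 0 + 3 * s 1 + 2 * s 2 + 3 * s 3) + 1
  have hN (s) (hs : s ∈ P.support) : 2 * s 0 + 3 * s 1 + 2 * s 2 + 3 * s 3 < N :=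
    Nat.lt_succ_of_le (Finset.single_le_sum
      (f := fun s : Fin 4 →₀ ℕ ↦ 2 * s 0 + 3 * s 1 + 2 * s 2 + 3 * s 3)
      (fun _ _ ↦ Nat.zero_le _) hs)
  have hvan : VanishesAt (homogenization N P) (chart p) := by
    refine hp N _ (isWeightedHomogeneous_homogenization fun s hs ↦ (hN s hs).le) ?_
    rintro _ ⟨τ, hτ, rfl⟩ u hu huτ
    obtain ⟨c, hc⟩ : ∃ c : ℂˣ, ∀ k, modularVec d τ k = (c : ℂ) ^ wt k * u k := Quotient.exact huτ
    by_cases h4 : u 4 = 0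
    · exact eval_homogenization_eq_zero hN h4
    have hy : yFun d 1 τ = c * u 4 := by simpa [wt, modularVec, yFun] using hc 4
    have hy0 : yFun d 1 τ ≠ 0 := hy ▸ mul_ne_zero c.ne_zero h4
    have hc0 : (c : ℂ) ≠ 0 := c.ne_zero
    have h0 : g₂ τ = c ^ 2 * u 0 := hc 0
    have h1 : g₃ τ = c ^ 3 * u 1 := hc 1
    have h2 : yFun d 2 τ = c ^ 2 * u 2 := hc 2
    have h3 : yFun d 3 τ = c ^ 3 * u 3 := hc 3
    rw [eval_homogenization_eq_aeval (fun s hs ↦ (hN s hs).le) (x := affineCoord d τ),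
      aeval_J_affineCoord d hi e hy0, mul_zero]
    · change _ = u 4 ^ 2 * (g₂ τ / yFun d 1 τ ^ 2)
      rw [h0, hy]
      field_simp
    · change _ = u 4 ^ 3 * (g₃ τ / yFun d 1 τ ^ 3)
      rw [h1, hy]
      field_simp
    · change _ = u 4 ^ 2 * (yFun d 2 τ / yFun d 1 τ ^ 2)
      rw [h2, hy]
      field_simp
    · change _ = u 4 ^ 3 * (yFun d 3 τ / yFun d 1 τ ^ 3)
      rw [h3, hy]
      field_simp
  have := hvan ![p 0, p 1, p 2, p 3, 1] (fun h ↦ one_ne_zero (congrFun h 4)) rfl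
  rw [eval_homogenization_eq_aeval (fun s hs ↦ (hN s hs).le) (x := p)] at this
  · simpa using this
  all_goals simp
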